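/- Let $d\in\mathbb N$ and let $\mathcal S$ be a finite or countably infinite state space. For each $x\in\mathbb R^d$ let $Q(x)=(q_{ij}(x))_{i,j\in\mathcal S}$ be a conservative, irreducible transition rate matrix (that is, $q_{ij}(x)\ge 0$ for $i\ne j$; $-q_{ii}(x)=\sum_{j\neq i}q_{ij}(x)<\infty$; and any state leads to any other state through finitely many positive rates), and assume that $$\kappa:=\sup_{i\in\mathcal S}\sum_{j\in\mathcal S,\,j\ne i}\ \sup_{x\in\mathbb R^d}q_{ij}(x)<\infty .$$ Then for every $x,y\in\mathbb R^d$ and every $i_0\in\mathcal S$ there are a probability space $(\Omega,\mathscr F,\mathbb P)$ and, defined on it, two $\mathcal S$-valued processes $(Y^x_t)_{t\ge0}$ and $(\widetilde Y^y_t)_{t\ge0}$ such that $(Y^x_t)$ is a continuous-time Markov chain with $Q$-matrix $Q(x)$ and $Y^x_0=i_0$ almost surely, $(\widetilde Y^y_t)$ is a continuous-time Markov chain with $Q$-matrix $Q(y)$ and $\widetilde Y^y_0=i_0$ almost surely (both with almost surely right-continuous paths with left limits, for the discrete topology on $\mathcal S$), the function $s\mapsto\mathbb P(Y^x_s\neq\widetilde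 Y^y_s)$ is measurable, and $$\frac1t\int_0^t\mathbb P\big(Y^x_s\neq\widetilde Y^y_s\big)\,\mathrm ds\ \le\ t\,\|Q(x)-Q(y)\|_{\ell_1}\qquad\text{for all } t>0,$$ where $\|Q(x)-Q(y)\|_{\ell_1}:=\sup_{i\in\mathcal S}\sum_{j\in\mathcal S,\,j\neq i}|q_{ij}(x)-q_{ij}(y)|$. Here a Markov chain with $Q$-matrix $Q$ is a process whose finite-dimensional distributions are given by its initial law and a transition function $(p_t(i,j))_{t\ge 0}$, i.e. stochastic matrices with $p_0(i,j)=\mathbf 1_{\{i=j\}}$, $p_{s+t}(i,j)=\sum_k p_s(i,k)p_t(k,j)$ and $p_\delta(i,j)=\mathbf 1_{\{i=j\}}+q_{ij}\delta+o(\delta)$ as $\delta\downarrow0$. -/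

import Mathlib

open Filter Topology MeasureTheory
open scoped NNReal ENNReal

/-- A conservative, irreducible transition rate matrix (`Q`-matrix) on the state space `S`:
nonnegative off-diagonal rates, every row sums to zero with finite total exit rate
`-Q i i = ∑_{j ≠ i} Q i j`, and any state leads to any other one through a finite chain of
positive rates. -/
structure IsConservativeIrreducibleQ {S : Type*} (Q : Matrix S S ℝ) : Prop where
  nonneg : ∀ i j, i ≠ j → 0 ≤ Q i j
  conservative : ∀ i, HasSum (fun j : {j : S // j ≠ i} => Q i j) (-Q i i)
  irreducible : ∀ i j, Relation.ReflTransGen (fun a b => a ≠ b ∧ 0 < Q a b) i j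

/-- `κ = sup_i ∑_{j ≠ i} sup_x q_{ij}(x)`, as an extended nonnegative number. -/
noncomputable def rateBound {X S : Type*} (Q : X → Matrix S S ℝ) : ℝ≥0∞ :=
  ⨆ i : S, ∑' j : {j : S // j ≠ i}, ⨆ x : X, ENNReal.ofReal (Q x i j)

/-- The condition (A2) on a family of rate matrices `Q(x)`, `x ∈ ℝ^d`: each of them is a
conservative irreducible transition rate matrix, and `κ < ∞`. -/
structure ConditionA2 {d : ℕ} {S : Type*}
    (Q : EuclideanSpace ℝ (Fin d) → Matrix S S ℝ) : Prop where
  isQ : ∀ x, IsConservativeIrreducibleQ (Q x)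
  bounded : rateBound Q < ⊤

/-- `‖A - B‖_{ℓ₁} = sup_i ∑_{j ≠ i} |A i j - B i j|`, as an extended nonnegative number. -/
noncomputable def l1Dist {S : Type*} (A B : Matrix S S ℝ) : ℝ≥0∞ :=
  ⨆ i : S, ∑' j : {j : S // j ≠ i}, ENNReal.ofReal |A i j - B i j|

open scoped Classical in
/-- `p` is an (honest) Markov transition function on `S` with `Q`-matrix `Q`: each `p t` is a
stochastic matrix, `p 0` is the identity, the Chapman-Kolmogorov equation holds, and
`p h i j = 1_{i = j} + Q i j * h + o(h)` as `h ↓ 0`. -/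
structure IsTransitionFunction {S : Type*} (Q : Matrix S S ℝ) (p : ℝ≥0 → S → S → ℝ) : Prop where
  nonneg : ∀ t i j, 0 ≤ p t i j
  sum_one : ∀ t i, HasSum (fun j => p t i j) 1
  zero : ∀ i j, p 0 i j = if i = j then 1 else 0
  chapman_kolmogorov : ∀ s t i j, HasSum (fun k => p s i k * p t k j) (p (s + t) i j)
  rate : ∀ i j, Tendsto (fun h : ℝ≥0 => (p h i j - if i = j then 1 else 0) / (h : ℝ))
    (𝓝[>] 0) (𝓝 (Q i j))

/-- `Y = (Y_t)_{t ≥ 0}` is, under `P`, a continuous-time Markov chain on `S` with `Q`-matrix `Q`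
started from `i₀`: it has a transition function `p` with `Q`-matrix `Q` that determines its
finite-dimensional distributions, and almost surely its paths are right-continuous with left
limits for the discrete topology of `S`. -/
structure IsMarkovChain {S : Type*} [MeasurableSpace S] (Q : Matrix S S ℝ) (i₀ : S)
    {Ω : Type*} [MeasurableSpace Ω] (P : Measure Ω) (Y : ℝ≥0 → Ω → S) : Prop where
  measurable : ∀ t, Measurable (Y t)
  initial : ∀ᵐ ω ∂P, Y 0 ω = i₀
  right_continuous : ∀ᵐ ω ∂P, ∀ t, ∀ᶠ s in 𝓝[>] t, Y s ω = Y t ω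
  left_limits : ∀ᵐ ω ∂P, ∀ t, ∃ i, ∀ᶠ s in 𝓝[<] t, Y s ω = i
  markov : ∃ p, IsTransitionFunction Q p ∧
    ∀ (n : ℕ) (t : ℕ → ℝ≥0), Monotone t → ∀ i : ℕ → S,
      P {ω | ∀ k ≤ n, Y (t k) ω = i k} = P {ω | Y (t 0) ω = i 0} *
        ∏ k ∈ Finset.range n, ENNReal.ofReal (p (t (k + 1) - t k) (i k) (i (k + 1)))

/-! The proof is a coupled uniformization. Fix a rate `r` with `r ≥ 2κ` and `r > 0`, and let a
single Poisson clock of rate `r` drive both chains. At each ring an independent mark `m` is drawn,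
and the chains move by update maps, `i ↦ f i m` and `i ↦ g i m`. If `f i m` has law `P i ·` with
`Q(x) = r (P - I)`, the first process is a Markov chain with matrix `Q(x)` and transition function
`∑ₙ e^{-rt} (rt)ⁿ/n! Pⁿ`; likewise for `g` and `Q(y)`.

For each `i` the pair `(f i m, g i m)` is coupled so that it disagrees with probability at most `δ =
‖Q(x) - Q(y)‖ / r` (`exists_jump_coupling`). Since both chains start together and read the same
marks, they differ after `n` rings with probability at most `n δ` (`markedLaw_jumpCount_ne_le`).
Averaging over the Poisson number of rings gives at most `r t δ = t ‖Q(x) - Q(y)‖` at time `t`, and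
the time average over `(0, t]` obeys the same bound.

The probabilistic core is `markedLaw_jumpCount_stateAt`, the Markov property at a fixed time jointly
with the number of rings. It is proved by induction on that number, splitting off the first holding
time and mark. -/

section SeqCons

/-! ### Self-similarity of i.i.d. sequences -/

/-- Prepend an element to a sequence. -/
def seqCons {α : Type*} (a : α) (ω : ℕ → α) : ℕ → α
  | 0 => a
  | n + 1 => ω n

@[simp] theorem seqCons_zero {α : Type*} (a : α) (ω : ℕ → α) : seqCons a ω 0 = a := rfl

@[simp] theorem seqCons_succ {α : Type*} (a : α) (ω : ℕ → α) (n : ℕ) :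
    seqCons a ω (n + 1) = ω n := rfl

@[fun_prop]
theorem measurable_seqCons {α : Type*} [MeasurableSpace α] :
    Measurable fun p : α × (ℕ → α) => seqCons p.1 p.2 := by
  refine measurable_pi_lambda _ fun n => ?_
  cases n with
  | zero => exact measurable_fst
  | succ n => exact (measurable_pi_apply n).comp measurable_snd

/-- A fresh independent head leaves an i.i.d. sequence i.i.d.; every first-step argument below rests
on this. -/
theorem map_seqCons_infinitePi {α : Type*} [MeasurableSpace α] (ν : Measure α)
    [IsProbabilityMeasure ν] :
    (ν.prod (Measure.infinitePi fun _ : ℕ => ν)).map (fun p => seqCons p.1 p.2) =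
      Measure.infinitePi fun _ : ℕ => ν := by
  classical
  refine Measure.eq_infinitePi _ fun s t ht => ?_
  obtain ⟨N, hN⟩ : ∃ N, s ⊆ Finset.range (N + 1) :=
    ⟨s.sup id, fun i hi => Finset.mem_range.2 (Nat.lt_succ_of_le (Finset.le_sup (f := id) hi))⟩
  -- Padding with `univ` turns a cylinder over an arbitrary finite set into one over an initial
  -- segment, whose preimage is a product of head and tail.
  set t' : ℕ → Set α := fun i => if i ∈ s then t i else Set.univ with ht'
  have mt' : ∀ i, MeasurableSet (t' i) := fun i => by
    by_cases hi : i ∈ s <;> simp [ht', hi, ht]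
  have hprod : ∏ i ∈ s, ν (t i) = ∏ i ∈ Finset.range (N + 1), ν (t' i) := by
    rw [← Finset.prod_subset hN]
    · exact Finset.prod_congr rfl fun i hi => by simp [ht', hi]
    · intro i _ hi
      simp [ht', hi]
  have hpre : (fun p : α × (ℕ → α) => seqCons p.1 p.2) ⁻¹' (Set.pi s t) =
      t' 0 ×ˢ Set.pi (Finset.range N) (fun i => t' (i + 1)) := by
    ext ⟨a, ω⟩
    simp only [Set.mem_preimage, Set.mem_pi, Set.mem_prod, Finset.mem_coe, Finset.mem_range]
    constructor
    · intro h
      refine ⟨?_, fun i _ => ?_⟩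
      · by_cases h0 : 0 ∈ s
        · simpa [ht', h0] using h 0 h0
        · simp [ht', h0]
      · by_cases h0 : i + 1 ∈ s
        · simpa [ht', h0] using h (i + 1) h0
        · simp [ht', h0]
    · rintro ⟨h0, h⟩ i hi
      cases i with
      | zero => simpa [ht', hi] using h0
      | succ i =>
        have := h i (by have := Finset.mem_range.1 (hN hi); omega)
        simpa [ht', hi] using this
  rw [Measure.map_apply measurable_seqCons (MeasurableSet.pi s.countable_toSet fun i _ => ht i),
    hpre, Measure.prod_prod, Measure.infinitePi_pi _ (fun i _ => mt' _), hprod,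
    Finset.prod_range_succ', mul_comm]

end SeqCons

/-! ### Exponential holding times and Poisson weights -/

section Exponential

open ProbabilityTheory

theorem lintegral_expMeasure (r : ℝ) {f : ℝ → ℝ≥0∞} (hf : Measurable f) :
    ∫⁻ s, f s ∂expMeasure r =
      ∫⁻ s in Set.Ioi 0, ENNReal.ofReal (r * Real.exp (-(r * s))) * f s := by
  have h1 : Measurable (gammaPDF 1 r) := (measurable_gammaPDFReal 1 r).ennreal_ofReal
  rw [expMeasure, gammaMeasure, lintegral_withDensity_eq_lintegral_mul _ h1 hf,
    setLIntegral_congr Ioi_ae_eq_Ici, ← lintegral_indicator measurableSet_Ici]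
  refine lintegral_congr fun s => ?_
  have h2 : gammaPDF 1 r s = exponentialPDF r s := rfl
  rw [Pi.mul_apply, h2, exponentialPDF_eq]
  by_cases hs : 0 ≤ s <;> simp [hs]

theorem setLIntegral_expMeasure (r : ℝ) {A : Set ℝ} (hA : MeasurableSet A) {f : ℝ → ℝ≥0∞}
    (hf : Measurable f) :
    ∫⁻ s in A, f s ∂expMeasure r =
      ∫⁻ s in A ∩ Set.Ioi 0, ENNReal.ofReal (r * Real.exp (-(r * s))) * f s := by
  rw [← lintegral_indicator hA, lintegral_expMeasure r (hf.indicator hA),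
    ← Measure.restrict_restrict hA, ← lintegral_indicator hA]
  refine lintegral_congr fun s => ?_
  by_cases hs : s ∈ A <;> simp [hs]

theorem ae_pos_expMeasure (r : ℝ) : ∀ᵐ s ∂expMeasure r, 0 < s := by
  have h : expMeasure r (Set.Iic 0) = 0 := by
    rw [← setLIntegral_one, setLIntegral_expMeasure r measurableSet_Iic measurable_const,
      Set.Iic_inter_Ioi]
    simp
  simp only [ae_iff, not_lt]
  exact h

/-- Lack of memory: beyond `t`, the residual time `s - t` is again exponential. -/
theorem setLIntegral_expMeasure_Ioi_sub (r : ℝ) {t : ℝ} (ht : 0 ≤ t) {f : ℝ → ℝ≥0∞}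
    (hf : Measurable f) :
    ∫⁻ s in Set.Ioi t, f (s - t) ∂expMeasure r =
      ENNReal.ofReal (Real.exp (-(r * t))) * ∫⁻ s, f s ∂expMeasure r := by
  rw [setLIntegral_expMeasure r measurableSet_Ioi (by fun_prop), lintegral_expMeasure r hf,
    Set.inter_eq_left.2 (Set.Ioi_subset_Ioi ht), ← lintegral_const_mul _ (by fun_prop)]
  have h := (measurePreserving_add_right (volume : Measure ℝ) t).setLIntegral_comp_preimage
    (s := Set.Ioi t) measurableSet_Ioi
    (f := fun s => ENNReal.ofReal (r * Real.exp (-(r * s))) * f (s - t)) (by fun_prop)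
  rw [← h]
  have : (fun x => x + t) ⁻¹' Set.Ioi t = Set.Ioi 0 := by ext; simp
  rw [this]
  refine lintegral_congr fun s => ?_
  rw [← mul_assoc, ← ENNReal.ofReal_mul (Real.exp_pos _).le, add_sub_cancel_right,
    mul_left_comm, ← Real.exp_add]
  ring_nf

/-- The Poisson weight `e^{-a} a^n / n!`. -/
noncomputable def poissonWeight (a : ℝ) (n : ℕ) : ℝ≥0∞ :=
  ENNReal.ofReal (Real.exp (-a) * a ^ n / n.factorial)

@[fun_prop]
theorem measurable_poissonWeight (n : ℕ) : Measurable fun a => poissonWeight a n := by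
  unfold poissonWeight
  fun_prop

theorem tsum_poissonWeight {a : ℝ} (ha : 0 ≤ a) : ∑' n, poissonWeight a n = 1 := by
  have h := hasSum_one_poissonMeasure ⟨a, ha⟩
  have h' : HasSum (fun n : ℕ => Real.exp (-a) * a ^ n / n.factorial) 1 := h
  unfold poissonWeight
  rw [← ENNReal.ofReal_tsum_of_nonneg (fun n => by positivity) h'.summable, h'.tsum_eq,
    ENNReal.ofReal_one]

theorem tsum_poissonWeight_mul_nat {a : ℝ} (ha : 0 ≤ a) :
    ∑' n : ℕ, poissonWeight a n * n = ENNReal.ofReal a := by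
  rw [tsum_eq_zero_add' ENNReal.summable]
  have h : ∀ n : ℕ, poissonWeight a (n + 1) * ((n + 1 : ℕ) : ℝ≥0∞) =
      ENNReal.ofReal a * poissonWeight a n := fun n => by
    unfold poissonWeight
    rw [← ENNReal.ofReal_natCast, ← ENNReal.ofReal_mul (by positivity), ← ENNReal.ofReal_mul ha]
    congr 1
    rw [Nat.factorial_succ]
    have : (n.factorial : ℝ) ≠ 0 := by positivity
    push_cast
    field_simp
    ring
  simp_rw [h]
  rw [ENNReal.tsum_mul_left, tsum_poissonWeight ha]
  simp

theorem poissonWeight_toReal {a : ℝ} (ha : 0 ≤ a) (n : ℕ) :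
    (poissonWeight a n).toReal = Real.exp (-a) * a ^ n / n.factorial :=
  ENNReal.toReal_ofReal (by positivity)

theorem poissonWeight_ne_top (a : ℝ) (n : ℕ) : poissonWeight a n ≠ ⊤ := ENNReal.ofReal_ne_top

/-- Short-time expansion of a Poisson mixture. -/
theorem abs_tsum_poissonWeight_sub_le {K : ℕ → ℝ≥0∞} (hK : ∀ n, K n ≤ 1) {a : ℝ} (ha : 0 ≤ a) :
    |(∑' n, poissonWeight a n * K n).toReal - (K 0).toReal -
      a * ((K 1).toReal - (K 0).toReal)| ≤ 3 * a ^ 2 := by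
  -- Used for `K` and for the constant `1`; the latter identifies the tail mass as `1 - (1 + a)
  -- e^{-a}`, which is at most `a²` because `e^{-a} ≥ 1 - a`.
  have split : ∀ L : ℕ → ℝ≥0∞, (∀ n, L n ≤ 1) →
      ∑' n, poissonWeight a (n + 2) * L (n + 2) ≠ ⊤ ∧
      (∑' n, poissonWeight a n * L n).toReal = Real.exp (-a) * (L 0).toReal +
        (Real.exp (-a) * a * (L 1).toReal +
          (∑' n, poissonWeight a (n + 2) * L (n + 2)).toReal) := fun L hL => by
    have hfin : ∀ n, poissonWeight a n * L n ≠ ⊤ := fun n =>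
      ENNReal.mul_ne_top (poissonWeight_ne_top a n) ((hL n).trans_lt ENNReal.one_lt_top).ne
    have htot : ∑' n, poissonWeight a n * L n ≠ ⊤ := by
      refine ne_top_of_le_ne_top ENNReal.one_ne_top ?_
      rw [← tsum_poissonWeight ha]
      exact ENNReal.tsum_le_tsum fun n => mul_le_of_le_one_right' (hL n)
    have e1 : ∑' n, poissonWeight a n * L n = poissonWeight a 0 * L 0 +
        (poissonWeight a 1 * L 1 + ∑' n, poissonWeight a (n + 2) * L (n + 2)) := by
      rw [tsum_eq_zero_add' ENNReal.summable, tsum_eq_zero_add' ENNReal.summable]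
    have hrest : ∑' n, poissonWeight a (n + 2) * L (n + 2) ≠ ⊤ := by
      rw [e1] at htot
      exact (ENNReal.add_ne_top.1 (ENNReal.add_ne_top.1 htot).2).2
    refine ⟨hrest, ?_⟩
    rw [e1, ENNReal.toReal_add (hfin 0) (ENNReal.add_ne_top.2 ⟨hfin 1, hrest⟩),
      ENNReal.toReal_add (hfin 1) hrest, ENNReal.toReal_mul, ENNReal.toReal_mul,
      poissonWeight_toReal ha, poissonWeight_toReal ha]
    simp
  obtain ⟨-, h1⟩ := split K hK
  obtain ⟨hfin, h2⟩ := split (fun _ => 1) fun _ => le_rfl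
  simp only [mul_one, tsum_poissonWeight ha, ENNReal.toReal_one] at h2 hfin
  have hle : (∑' n, poissonWeight a (n + 2) * K (n + 2)).toReal ≤
      (∑' n, poissonWeight a (n + 2)).toReal :=
    ENNReal.toReal_mono hfin (ENNReal.tsum_le_tsum fun n => mul_le_of_le_one_right' (hK _))
  have h0 : 0 ≤ (∑' n, poissonWeight a (n + 2) * K (n + 2)).toReal := ENNReal.toReal_nonneg
  rw [h1]
  set R := (∑' n, poissonWeight a (n + 2) * K (n + 2)).toReal
  set T := (∑' n, poissonWeight a (n + 2)).toReal
  have hk : ∀ n, 0 ≤ (K n).toReal ∧ (K n).toReal ≤ 1 := fun n =>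
    ⟨ENNReal.toReal_nonneg, ENNReal.toReal_le_of_le_ofReal zero_le_one (by simpa using hK n)⟩
  obtain ⟨k00, k01⟩ := hk 0
  obtain ⟨k10, k11⟩ := hk 1
  set k0 := (K 0).toReal
  set k1 := (K 1).toReal
  have e0 : 1 - a ≤ Real.exp (-a) := by linarith [Real.add_one_le_exp (-a)]
  have e2 : Real.exp (-a) ≤ 1 := Real.exp_le_one_iff.2 (by linarith)
  have e3 : Real.exp (-a) ≤ 1 - a + a ^ 2 := by
    have h5 : Real.exp (-a) * (1 + a) ≤ 1 := by
      have h6 : Real.exp (-a) * Real.exp a = 1 := by rw [← Real.exp_add]; simp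
      rw [← h6]
      exact mul_le_mul_of_nonneg_left (by linarith [Real.add_one_le_exp a]) (Real.exp_pos _).le
    nlinarith
  set x := Real.exp (-a)
  have hR : R ≤ a ^ 2 := by nlinarith
  have hA : 0 ≤ (x - 1 + a) * k0 ∧ (x - 1 + a) * k0 ≤ a ^ 2 :=
    ⟨mul_nonneg (by linarith) k00, (mul_le_of_le_one_right (by linarith) k01).trans (by linarith)⟩
  have hB : 0 ≤ a * (1 - x) * k1 ∧ a * (1 - x) * k1 ≤ a ^ 2 :=
    ⟨mul_nonneg (mul_nonneg ha (by linarith)) k10,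
      (mul_le_of_le_one_right (mul_nonneg ha (by linarith)) k11).trans (by nlinarith)⟩
  -- Each of the three error terms lies in `[0, a²]`, whence the constant `3`.
  have e : x * k0 + (x * a * k1 + R) - k0 - a * (k1 - k0) =
      (x - 1 + a) * k0 - a * (1 - x) * k1 + R := by ring
  rw [e, abs_le]
  constructor <;> nlinarith [hA.1, hA.2, hB.1, hB.2]

/-- Conditioning on the first ring `s`, the other `n` fall in the remaining time `t - s`. This is
the inductive step that produces the Poisson law. -/
theorem setLIntegral_expMeasure_poissonWeight {r t : ℝ} (hr : 0 ≤ r) (ht : 0 ≤ t) (n : ℕ) :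
    ∫⁻ s in Set.Iic t, poissonWeight (r * (t - s)) n ∂expMeasure r =
      poissonWeight (r * t) (n + 1) := by
  rw [setLIntegral_expMeasure r measurableSet_Iic (by fun_prop), Set.Iic_inter_Ioi]
  have h1 : ∀ s ∈ Set.Ioc 0 t, ENNReal.ofReal (r * Real.exp (-(r * s))) *
      poissonWeight (r * (t - s)) n = ENNReal.ofReal
        (Real.exp (-(r * t)) * r ^ (n + 1) / n.factorial * (t - s) ^ n) := fun s hs => by
    unfold poissonWeight
    rw [← ENNReal.ofReal_mul (by positivity)]
    congr 1
    have : Real.exp (-(r * t)) = Real.exp (-(r * s)) * Real.exp (-(r * (t - s))) := by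
      rw [← Real.exp_add]; ring_nf
    rw [this, mul_pow]
    ring
  rw [setLIntegral_congr_fun measurableSet_Ioc h1, ← ofReal_integral_eq_lintegral_ofReal]
  · unfold poissonWeight
    congr 1
    rw [← intervalIntegral.integral_of_le ht, intervalIntegral.integral_const_mul,
      intervalIntegral.integral_comp_sub_left (fun s => s ^ n) t, integral_pow,
      Nat.factorial_succ]
    have : (n.factorial : ℝ) ≠ 0 := by positivity
    push_cast
    simp
    field_simp
    ring
  · exact (Continuous.integrableOn_Icc (by fun_prop)).mono_set Set.Ioc_subset_Icc_self
  · refine (ae_restrict_iff' measurableSet_Ioc).2 (ae_of_all _ fun s hs => ?_)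
    have : 0 ≤ t - s := sub_nonneg.2 hs.2
    simp only [Pi.zero_apply]
    positivity

end Exponential

/-! ### Jump times and states of a marked path -/

section JumpProcess

open ProbabilityTheory

variable {S M : Type*}

/-- The `n`-th jump time of a sequence of marked holding times. -/
def jumpTime (n : ℕ) (ω : ℕ → ℝ × M) : ℝ := ∑ k ∈ Finset.range n, (ω k).1

/-- Exactly `n` jumps have happened up to time `t`. -/
def JumpCount (n : ℕ) (t : ℝ) (ω : ℕ → ℝ × M) : Prop :=
  jumpTime n ω ≤ t ∧ t < jumpTime (n + 1) ω

/-- The embedded chain started from `i`, driven by the update map `f` and the marks of `ω`. -/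
def embeddedChain (f : S → M → S) (i : S) (ω : ℕ → ℝ × M) : ℕ → S
  | 0 => i
  | n + 1 => f (embeddedChain f i ω n) (ω n).2

/-- The jump process started from `i` is in state `j` at time `t`. -/
def StateAt (f : S → M → S) (i : S) (t : ℝ) (ω : ℕ → ℝ × M) (j : S) : Prop :=
  ∃ n, JumpCount n t ω ∧ embeddedChain f i ω n = j

theorem jumpTime_zero (ω : ℕ → ℝ × M) : jumpTime 0 ω = 0 := by simp [jumpTime]

theorem jumpTime_succ (n : ℕ) (ω : ℕ → ℝ × M) :
    jumpTime (n + 1) ω = jumpTime n ω + (ω n).1 := by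
  simp [jumpTime, Finset.sum_range_succ]

theorem jumpTime_succ_seqCons (n : ℕ) (a : ℝ × M) (ω : ℕ → ℝ × M) :
    jumpTime (n + 1) (seqCons a ω) = a.1 + jumpTime n ω := by
  simp [jumpTime, Finset.sum_range_succ', add_comm]

theorem jumpCount_zero_seqCons (t : ℝ) (a : ℝ × M) (ω : ℕ → ℝ × M) :
    JumpCount 0 t (seqCons a ω) ↔ 0 ≤ t ∧ t < a.1 := by
  simp [JumpCount, jumpTime_zero, jumpTime_succ_seqCons]

theorem jumpCount_succ_seqCons (n : ℕ) (t : ℝ) (a : ℝ × M) (ω : ℕ → ℝ × M) :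
    JumpCount (n + 1) t (seqCons a ω) ↔ JumpCount n (t - a.1) ω := by
  simp only [JumpCount, jumpTime_succ_seqCons]
  constructor <;> rintro ⟨h1, h2⟩ <;> constructor <;> linarith

theorem embeddedChain_succ_seqCons (f : S → M → S) (i : S) (a : ℝ × M) (ω : ℕ → ℝ × M) (n : ℕ) :
    embeddedChain f i (seqCons a ω) (n + 1) = embeddedChain f (f i a.2) ω n := by
  induction n with
  | zero => rfl
  | succ n ih => rw [embeddedChain, ih]; rfl

/-- `StateAt` is a relation, so this decomposition is purely algebraic and needs no positivity of
the holding times. -/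
theorem stateAt_seqCons (f : S → M → S) (i : S) (t : ℝ) (a : ℝ × M) (ω : ℕ → ℝ × M) (j : S) :
    StateAt f i t (seqCons a ω) j ↔
      ((0 ≤ t ∧ t < a.1) ∧ i = j) ∨ StateAt f (f i a.2) (t - a.1) ω j := by
  unfold StateAt
  constructor
  · rintro ⟨n, h1, h2⟩
    cases n with
    | zero => exact Or.inl ⟨(jumpCount_zero_seqCons _ _ _).1 h1, h2⟩
    | succ n => exact Or.inr ⟨n, (jumpCount_succ_seqCons _ _ _ _).1 h1,
        (embeddedChain_succ_seqCons f i a ω n).symm.trans h2⟩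
  · rintro (⟨h1, h2⟩ | ⟨n, h1, h2⟩)
    · exact ⟨0, (jumpCount_zero_seqCons _ _ _).2 h1, h2⟩
    · exact ⟨n + 1, (jumpCount_succ_seqCons _ _ _ _).2 h1,
        (embeddedChain_succ_seqCons f i a ω n).trans h2⟩

/-- Looking ahead from time `t` amounts to shortening the first holding time by `t`: the pathwise
counterpart of lack of memory. -/
theorem stateAt_add_seqCons (f : S → M → S) (i : S) {t u : ℝ} (ht : 0 ≤ t) (hu : 0 ≤ u) (s : ℝ)
    (m : M) (ω : ℕ → ℝ × M) (j : S) :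
    StateAt f i (t + u) (seqCons (s, m) ω) j ↔ StateAt f i u (seqCons (s - t, m) ω) j := by
  have h1 : t + u - s = u - (s - t) := by ring
  have h2 : (0 ≤ t + u ∧ t + u < s) ↔ (0 ≤ u ∧ u < s - t) :=
    ⟨fun h => ⟨hu, by linarith [h.2]⟩, fun h => ⟨by linarith, by linarith [h.2]⟩⟩
  rw [stateAt_seqCons, stateAt_seqCons, h1]
  simp only [h2]

theorem stateAt_seqCons_of_le (f : S → M → S) (i : S) {s t : ℝ} (h : s ≤ t) (m : M)
    (ω : ℕ → ℝ × M) (j : S) :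
    StateAt f i t (seqCons (s, m) ω) j ↔ StateAt f (f i m) (t - s) ω j := by
  rw [stateAt_seqCons]
  simp [not_lt.2 h]

theorem jumpTime_nonneg {ω : ℕ → ℝ × M} (h : ∀ k, 0 < (ω k).1) (n : ℕ) : 0 ≤ jumpTime n ω :=
  Finset.sum_nonneg fun k _ => (h k).le

instance isProbabilityMeasure_expMeasure_of_fact {r : ℝ} [hr : Fact (0 < r)] :
    IsProbabilityMeasure (expMeasure r) := isProbabilityMeasure_expMeasure hr.out

variable [MeasurableSpace M]

@[fun_prop]
theorem measurable_jumpTime (n : ℕ) : Measurable (jumpTime (M := M) n) := by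
  unfold jumpTime
  fun_prop

theorem measurableSet_jumpCount_prod (n : ℕ) :
    MeasurableSet {p : ℝ × (ℕ → ℝ × M) | JumpCount n p.1 p.2} :=
  (measurableSet_le ((measurable_jumpTime n).comp measurable_snd) measurable_fst).inter
    (measurableSet_lt measurable_fst ((measurable_jumpTime (n + 1)).comp measurable_snd))

theorem measurableSet_jumpCount (n : ℕ) (t : ℝ) :
    MeasurableSet {ω : ℕ → ℝ × M | JumpCount n t ω} :=
  measurable_prodMk_left (x := t) (measurableSet_jumpCount_prod n)

variable [Countable S] [MeasurableSpace S] [DiscreteMeasurableSpace S]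

theorem measurable_embeddedChain {f : S → M → S} (hf : ∀ i, Measurable (f i)) (i : S) (n : ℕ) :
    Measurable fun ω => embeddedChain f i ω n := by
  induction n with
  | zero => exact measurable_const
  | succ n ih =>
    have h : Measurable (fun p : S × M => f p.1 p.2) :=
      measurable_from_prod_countable_right fun i => hf i
    exact h.comp (ih.prodMk (measurable_snd.comp (measurable_pi_apply n)))

theorem measurableSet_embeddedChain {f : S → M → S} (hf : ∀ i, Measurable (f i)) (i : S) (n : ℕ)
    (j : S) : MeasurableSet {ω : ℕ → ℝ × M | embeddedChain f i ω n = j} :=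
  measurable_embeddedChain hf i n (.singleton j)

theorem measurableSet_stateAt_prod {f : S → M → S} (hf : ∀ i, Measurable (f i)) (i j : S) :
    MeasurableSet {p : ℝ × (ℕ → ℝ × M) | StateAt f i p.1 p.2 j} := by
  simp only [StateAt, Set.ofPred_exists]
  exact MeasurableSet.iUnion fun n => (measurableSet_jumpCount_prod n).inter
    (((measurable_embeddedChain hf i n).comp measurable_snd) (.singleton j))

theorem measurableSet_stateAt {f : S → M → S} (hf : ∀ i, Measurable (f i)) (i : S) (t : ℝ)
    (j : S) : MeasurableSet {ω : ℕ → ℝ × M | StateAt f i t ω j} :=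
  measurable_prodMk_left (x := t) (measurableSet_stateAt_prod hf i j)

theorem measurableSet_forall_stateAt {f : S → M → S} (hf : ∀ i, Measurable (f i)) (i : S)
    {ι : Type*} [Countable ι] (v : ι → ℝ) (c : ι → S) :
    MeasurableSet {ω : ℕ → ℝ × M | ∀ k, StateAt f i (v k) ω (c k)} := by
  rw [Set.ofPred_forall]
  exact MeasurableSet.iInter fun k => measurableSet_stateAt hf i _ _

/-- The law of an i.i.d. sequence of exponential holding times with independent marks. -/
noncomputable def markedLaw (r : ℝ) [Fact (0 < r)] (μ : Measure M) [IsProbabilityMeasure μ] :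
    Measure (ℕ → ℝ × M) :=
  Measure.infinitePi fun _ => (expMeasure r).prod μ

end JumpProcess

/-! ### First-step analysis and the Markov property -/

section JumpProcessLaw

open ProbabilityTheory

variable {S M : Type*} [MeasurableSpace M] (r : ℝ) [hr : Fact (0 < r)] (μ : Measure M)
  [IsProbabilityMeasure μ]

instance : IsProbabilityMeasure (markedLaw r μ) := by
  unfold markedLaw
  infer_instance

theorem measurable_markedLaw_seqCons {A : Set (ℕ → ℝ × M)} (hA : MeasurableSet A) :
    Measurable fun p : ℝ × M => markedLaw r μ {ω | seqCons p ω ∈ A} :=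
  measurable_measure_prodMk_left (measurable_seqCons hA)

theorem measurable_lintegral_markedLaw_seqCons {A : Set (ℕ → ℝ × M)} (hA : MeasurableSet A) :
    Measurable fun s : ℝ => ∫⁻ m, markedLaw r μ {ω | seqCons (s, m) ω ∈ A} ∂μ :=
  (measurable_markedLaw_seqCons r μ hA).lintegral_prod_right'

theorem markedLaw_eq_lintegral {A : Set (ℕ → ℝ × M)} (hA : MeasurableSet A) :
    markedLaw r μ A =
      ∫⁻ s, ∫⁻ m, markedLaw r μ {ω | seqCons (s, m) ω ∈ A} ∂μ ∂expMeasure r := by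
  conv_lhs => rw [markedLaw, ← map_seqCons_infinitePi, Measure.map_apply measurable_seqCons hA,
    Measure.prod_apply (measurable_seqCons hA)]
  exact lintegral_prod _ (measurable_markedLaw_seqCons r μ hA).aemeasurable

theorem ae_holding_pos : ∀ᵐ ω ∂markedLaw r μ, ∀ k, 0 < (ω k).1 := by
  rw [ae_all_iff]
  intro k
  have h : ∀ᵐ p ∂((expMeasure r).prod μ), 0 < p.1 :=
    Measure.quasiMeasurePreserving_fst.ae (ae_pos_expMeasure r)
  exact (measurePreserving_eval_infinitePi
    (fun _ : ℕ => (expMeasure r).prod μ) k).quasiMeasurePreserving.ae h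

/-- First-step decomposition of an event that forces at least one jump before time `t`. -/
theorem markedLaw_eq_setLIntegral_of_jumpCount_succ {A : Set (ℕ → ℝ × M)} (hA : MeasurableSet A)
    {n : ℕ} {t : ℝ} (hJ : ∀ ω ∈ A, JumpCount (n + 1) t ω) :
    markedLaw r μ A =
      ∫⁻ s in Set.Iic t, ∫⁻ m, markedLaw r μ {ω | seqCons (s, m) ω ∈ A} ∂μ ∂expMeasure r := by
  rw [markedLaw_eq_lintegral r μ hA, ← lintegral_indicator measurableSet_Iic]
  refine lintegral_congr fun s => ?_
  by_cases hs : s ≤ t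
  · simp [hs]
  -- If the first ring comes after `t`, the later jump times would have to be negative, which almost
  -- surely fails.
  · have h0 : ∀ m, markedLaw r μ {ω | seqCons (s, m) ω ∈ A} = 0 := fun m => by
      rw [measure_eq_zero_iff_ae_notMem]
      filter_upwards [ae_holding_pos r μ] with ω hpos hω
      have h1 := ((jumpCount_succ_seqCons _ _ _ _).1 (hJ _ hω)).1
      have h2 := jumpTime_nonneg hpos n
      simp only at h1
      linarith
    simp [hs, h0]

/-- The `n`-step transition probabilities of the embedded chain. -/
noncomputable def stepProb (f : S → M → S) : ℕ → S → S → ℝ≥0∞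
  | 0, i, j => open scoped Classical in if i = j then 1 else 0
  | n + 1, i, j => ∫⁻ m, stepProb f n (f i m) j ∂μ

variable [Countable S] [MeasurableSpace S] [DiscreteMeasurableSpace S]

/-- Given the ring count and the state at time `t`, the future is a fresh process from that state.
Carrying the count permits induction on the first ring; an empty `ι` gives the joint law of count
and state. -/
theorem markedLaw_jumpCount_stateAt {f : S → M → S} (hf : ∀ i, Measurable (f i))
    {ι : Type*} [Countable ι] {u : ι → ℝ} (hu : ∀ k, 0 ≤ u k) (c : ι → S) (n : ℕ) (i j : S)
    {t : ℝ} (ht : 0 ≤ t) :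
    markedLaw r μ {ω | JumpCount n t ω ∧ embeddedChain f i ω n = j ∧
        ∀ k, StateAt f i (t + u k) ω (c k)} =
      poissonWeight (r * t) n * stepProb μ f n i j *
        markedLaw r μ {ω | ∀ k, StateAt f j (u k) ω (c k)} := by
  have mE : ∀ (i : S) (v : ι → ℝ), MeasurableSet {ω | ∀ k, StateAt f i (v k) ω (c k)} :=
    fun i v => measurableSet_forall_stateAt hf i v c
  have mA : ∀ n i t, MeasurableSet {ω | JumpCount n t ω ∧ embeddedChain f i ω n = j ∧
      ∀ k, StateAt f i (t + u k) ω (c k)} := fun n i t =>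
    (measurableSet_jumpCount n t).inter
      ((measurableSet_embeddedChain hf i n j).inter (mE i _))
  induction n generalizing i t with
  | zero =>
    by_cases hij : i = j
    · subst hij
      rw [markedLaw_eq_lintegral r μ (mA 0 i t)]
      -- No ring by time `t` means `s > t`; the future then sees the residual time `s - t`.
      have h1 : ∀ s, (∫⁻ m, markedLaw r μ {ω | seqCons (s, m) ω ∈ {ω | JumpCount 0 t ω ∧
          embeddedChain f i ω 0 = i ∧ ∀ k, StateAt f i (t + u k) ω (c k)}} ∂μ) =
          (Set.Ioi t).indicator (fun s => ∫⁻ m, markedLaw r μ {ω | seqCons (s - t, m) ω ∈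
            {ω | ∀ k, StateAt f i (u k) ω (c k)}} ∂μ) s := fun s => by
        by_cases hs : t < s
        · simp [hs, jumpCount_zero_seqCons, ht, embeddedChain, stateAt_add_seqCons f i ht (hu _)]
        · simp [hs, jumpCount_zero_seqCons]
      simp_rw [h1]
      rw [lintegral_indicator measurableSet_Ioi,
        setLIntegral_expMeasure_Ioi_sub r ht (measurable_lintegral_markedLaw_seqCons r μ (mE i u)),
        ← markedLaw_eq_lintegral r μ (mE i u)]
      simp [poissonWeight, stepProb]
    · simp [embeddedChain, stepProb, hij]
  | succ n ih =>
    -- After a first ring at `s ≤ t`, the path restarts from `f i m` with horizon `t - s` and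
    -- unchanged offsets `u k`, so the induction hypothesis applies.
    rw [markedLaw_eq_setLIntegral_of_jumpCount_succ r μ (mA (n + 1) i t) (n := n) (t := t)
      (fun ω hω => hω.1)]
    have h1 : ∀ s ∈ Set.Iic t, (∫⁻ m, markedLaw r μ {ω | seqCons (s, m) ω ∈
        {ω | JumpCount (n + 1) t ω ∧ embeddedChain f i ω (n + 1) = j ∧
          ∀ k, StateAt f i (t + u k) ω (c k)}} ∂μ) =
        poissonWeight (r * (t - s)) n * (stepProb μ f (n + 1) i j *
          markedLaw r μ {ω | ∀ k, StateAt f j (u k) ω (c k)}) := fun s hs => by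
      have hs' : 0 ≤ t - s := sub_nonneg.2 hs
      have h2 : ∀ m, markedLaw r μ {ω | seqCons (s, m) ω ∈
          {ω | JumpCount (n + 1) t ω ∧ embeddedChain f i ω (n + 1) = j ∧
            ∀ k, StateAt f i (t + u k) ω (c k)}} =
          poissonWeight (r * (t - s)) n * (stepProb μ f n (f i m) j *
          markedLaw r μ {ω | ∀ k, StateAt f j (u k) ω (c k)}) := fun m => by
        rw [← mul_assoc, ← ih (f i m) hs']
        congr 1
        ext ω
        simp only [Set.mem_ofPred_eq, jumpCount_succ_seqCons, embeddedChain_succ_seqCons]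
        refine and_congr_right fun _ => and_congr_right fun _ => forall_congr' fun k => ?_
        have h3 : s ≤ t + u k := le_add_of_le_of_nonneg hs (hu k)
        rw [stateAt_seqCons_of_le f i h3, add_sub_right_comm]
      simp_rw [h2]
      have mK : Measurable fun m => stepProb μ f n (f i m) j :=
        (measurable_of_countable (fun k : S => stepProb μ f n k j)).comp (hf i)
      rw [lintegral_const_mul _ (by fun_prop), lintegral_mul_const _ mK, stepProb]
    rw [setLIntegral_congr_fun measurableSet_Iic h1, lintegral_mul_const _ (by fun_prop),
      setLIntegral_expMeasure_poissonWeight hr.out.le ht, mul_assoc]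

/-- A one-point state space and no future times reduce the Markov property to the law of the count.
-/
theorem markedLaw_jumpCount (n : ℕ) {t : ℝ} (ht : 0 ≤ t) :
    markedLaw r μ {ω | JumpCount n t ω} = poissonWeight (r * t) n := by
  have h := markedLaw_jumpCount_stateAt r μ (f := fun (_ : Unit) (_ : M) => ())
    (fun _ => measurable_const) (ι := Empty) (u := fun k => k.elim) (fun k => k.elim)
    (fun k => k.elim) n () () ht
  have h1 : ∀ n, stepProb μ (fun (_ : Unit) (_ : M) => ()) n () () = 1 := fun n => by
    induction n with
    | zero => simp [stepProb]
    | succ n ih => simp [stepProb, ih]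
  simpa [h1] using h

/-- A union bound over rings: chains still together part at the next ring with probability at most
`δ`. -/
theorem markedLaw_jumpCount_ne_le {f g : S → M → S} (hf : ∀ i, Measurable (f i))
    (hg : ∀ i, Measurable (g i)) {δ : ℝ≥0∞} (hδ : ∀ i, μ {m | f i m ≠ g i m} ≤ δ) (n : ℕ) (i : S)
    {t : ℝ} (ht : 0 ≤ t) :
    markedLaw r μ {ω | JumpCount n t ω ∧ embeddedChain f i ω n ≠ embeddedChain g i ω n} ≤
      poissonWeight (r * t) n * (n * δ) := by
  induction n generalizing i t with
  | zero => simp [embeddedChain]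
  | succ n ih =>
    have mA : MeasurableSet {ω | JumpCount (n + 1) t ω ∧
        embeddedChain f i ω (n + 1) ≠ embeddedChain g i ω (n + 1)} :=
      (measurableSet_jumpCount _ t).inter (measurableSet_eq_fun
        (measurable_embeddedChain hf i _) (measurable_embeddedChain hg i _)).compl
    rw [markedLaw_eq_setLIntegral_of_jumpCount_succ r μ mA (n := n) (t := t) (fun ω hω => hω.1),
      ← setLIntegral_expMeasure_poissonWeight hr.out.le ht, ← lintegral_mul_const _ (by fun_prop)]
    refine setLIntegral_mono (by fun_prop) fun s hs => ?_
    have hs' : 0 ≤ t - s := sub_nonneg.2 hs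
    have mD : MeasurableSet {m | f i m ≠ g i m} := (measurableSet_eq_fun (hf i) (hg i)).compl
    have h2 : ∀ m, markedLaw r μ {ω | seqCons (s, m) ω ∈ {ω | JumpCount (n + 1) t ω ∧
        embeddedChain f i ω (n + 1) ≠ embeddedChain g i ω (n + 1)}} ≤
        poissonWeight (r * (t - s)) n * (Set.indicator {m | f i m ≠ g i m} 1 m + n * δ) :=
      fun m => by
        simp only [Set.mem_ofPred_eq, jumpCount_succ_seqCons, embeddedChain_succ_seqCons]
        -- After agreement, both chains restart from one state. After disagreement, only the count
        -- is kept, and `hδ` pays for the mark.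
        by_cases hm : f i m = g i m
        · simpa [hm] using ih (g i m) hs'
        · rw [Set.indicator_of_mem (by exact hm), mul_add, Pi.one_apply, mul_one,
            ← markedLaw_jumpCount r μ n hs']
          exact le_add_right (measure_mono fun ω hω => hω.1)
    refine (lintegral_mono h2).trans ?_
    rw [lintegral_const_mul _ ((measurable_one.indicator mD).add_const _),
      lintegral_add_right _ measurable_const, lintegral_indicator_one mD]
    gcongr
    simp only [lintegral_const, measure_univ, mul_one]
    push_cast
    rw [add_mul, one_mul, add_comm]
    gcongr
    exact hδ i

end JumpProcessLaw

/-! ### Path regularity and measurability of the jump process -/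

section JumpPaths

variable {S M : Type*}

/-- All holding times are positive and the jump times do not accumulate. -/
def NonExplosive (ω : ℕ → ℝ × M) : Prop :=
  (∀ k, 0 < (ω k).1) ∧ ∀ m : ℕ, ∃ n, JumpCount n (m : ℝ) ω

theorem jumpTime_strictMono {ω : ℕ → ℝ × M} (h : ∀ k, 0 < (ω k).1) :
    StrictMono fun n => jumpTime n ω :=
  strictMono_nat_of_lt_succ fun n => by
    rw [jumpTime_succ]
    exact lt_add_of_pos_right _ (h n)

theorem JumpCount.unique {ω : ℕ → ℝ × M} (h : ∀ k, 0 < (ω k).1) {t : ℝ} {m n : ℕ}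
    (hm : JumpCount m t ω) (hn : JumpCount n t ω) : m = n := by
  have h1 : m < n + 1 := (jumpTime_strictMono h).lt_iff_lt.1 (hm.1.trans_lt hn.2)
  have h2 : n < m + 1 := (jumpTime_strictMono h).lt_iff_lt.1 (hn.1.trans_lt hm.2)
  omega

theorem NonExplosive.exists_jumpCount {ω : ℕ → ℝ × M} (h : NonExplosive ω) {t : ℝ}
    (ht : 0 ≤ t) : ∃ n, JumpCount n t ω := by
  classical
  obtain ⟨m, hm⟩ := exists_nat_ge t
  obtain ⟨n, hn⟩ := h.2 m
  have hex : ∃ n, t < jumpTime (n + 1) ω := ⟨n, hm.trans_lt hn.2⟩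
  refine ⟨Nat.find hex, ?_, Nat.find_spec hex⟩
  rcases Nat.eq_zero_or_pos (Nat.find hex) with h0 | h0
  · rw [h0, jumpTime_zero]
    exact ht
  · have h1 := Nat.find_min hex (Nat.sub_one_lt_of_lt h0)
    rwa [Nat.sub_add_cancel h0, not_lt] at h1

open scoped Classical in
/-- The right-continuous jump process started from `i` and driven by the update map `f`; it stays
at `i` on the exceptional paths that are not `NonExplosive`. -/
noncomputable def jumpProcess (f : S → M → S) (i : S) (t : ℝ≥0) (ω : ℕ → ℝ × M) : S :=
  if NonExplosive ω then embeddedChain f i ω (sInf {n | JumpCount n t ω}) else i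

theorem jumpProcess_eq_embeddedChain (f : S → M → S) (i : S) {t : ℝ≥0} {ω : ℕ → ℝ × M}
    (h : NonExplosive ω) {n : ℕ} (hn : JumpCount n t ω) :
    jumpProcess f i t ω = embeddedChain f i ω n := by
  have h1 : {n | JumpCount n t ω} = {n} := by
    ext m
    simp only [Set.mem_ofPred_eq, Set.mem_singleton_iff]
    exact ⟨fun hm => hm.unique h.1 hn, fun hm => hm ▸ hn⟩
  rw [jumpProcess, if_pos h, h1, csInf_singleton]

theorem jumpProcess_eq_iff (f : S → M → S) (i : S) {t : ℝ≥0} {ω : ℕ → ℝ × M}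
    (h : NonExplosive ω) (j : S) : jumpProcess f i t ω = j ↔ StateAt f i t ω j := by
  obtain ⟨n, hn⟩ := h.exists_jumpCount t.2
  rw [jumpProcess_eq_embeddedChain f i h hn]
  refine ⟨fun hj => ⟨n, hn, hj⟩, ?_⟩
  rintro ⟨m, hm, hj⟩
  rwa [hn.unique h.1 hm]

theorem jumpProcess_zero (f : S → M → S) (i : S) {ω : ℕ → ℝ × M} (h : NonExplosive ω) :
    jumpProcess f i 0 ω = i := by
  refine jumpProcess_eq_embeddedChain f i h (n := 0) ⟨?_, ?_⟩
  · simp [jumpTime_zero]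
  · simpa [jumpTime_succ, jumpTime_zero] using h.1 0

theorem jumpProcess_right_continuous (f : S → M → S) (i : S) {ω : ℕ → ℝ × M}
    (h : NonExplosive ω) (t : ℝ≥0) :
    ∀ᶠ s in 𝓝[>] t, jumpProcess f i s ω = jumpProcess f i t ω := by
  obtain ⟨n, hn⟩ := h.exists_jumpCount t.2
  have h1 : ∀ᶠ s : ℝ≥0 in 𝓝[>] t, (s : ℝ) < jumpTime (n + 1) ω :=
    nhdsWithin_le_nhds ((NNReal.continuous_coe.tendsto t).eventually (gt_mem_nhds hn.2))
  filter_upwards [h1, self_mem_nhdsWithin] with s hs hst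
  have hts : (t : ℝ) < s := NNReal.coe_lt_coe.2 hst
  rw [jumpProcess_eq_embeddedChain f i h hn,
    jumpProcess_eq_embeddedChain f i h ⟨hn.1.trans hts.le, hs⟩]

theorem jumpProcess_left_limits (f : S → M → S) (i : S) {ω : ℕ → ℝ × M}
    (h : NonExplosive ω) (t : ℝ≥0) : ∃ j, ∀ᶠ s in 𝓝[<] t, jumpProcess f i s ω = j := by
  rcases eq_or_ne t 0 with rfl | ht
  · refine ⟨i, ?_⟩
    simp
  obtain ⟨n, hn1, hn2⟩ : ∃ n, jumpTime n ω < t ∧ (t : ℝ) ≤ jumpTime (n + 1) ω := by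
    obtain ⟨n, hn⟩ := h.exists_jumpCount t.2
    rcases hn.1.lt_or_eq with h1 | h1
    · exact ⟨n, h1, hn.2.le⟩
    -- Here `t` is itself a jump time, so the left limit is the state held on the preceding
    -- interval.
    · cases n with
      | zero =>
        rw [jumpTime_zero] at h1
        exact absurd (NNReal.coe_eq_zero.1 h1.symm) ht
      | succ n => exact ⟨n, (jumpTime_strictMono h.1 n.lt_succ_self).trans_eq h1, h1.ge⟩
  refine ⟨embeddedChain f i ω n, ?_⟩
  have h1 : ∀ᶠ s : ℝ≥0 in 𝓝[<] t, jumpTime n ω < (s : ℝ) :=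
    nhdsWithin_le_nhds ((NNReal.continuous_coe.tendsto t).eventually (lt_mem_nhds hn1))
  filter_upwards [h1, self_mem_nhdsWithin] with s hs hst
  have hts : (s : ℝ) < t := NNReal.coe_lt_coe.2 hst
  exact jumpProcess_eq_embeddedChain f i h ⟨hs.le, hts.trans_le hn2⟩

variable [MeasurableSpace M]

theorem measurableSet_nonExplosive : MeasurableSet {ω : ℕ → ℝ × M | NonExplosive ω} := by
  have h1 : MeasurableSet {ω : ℕ → ℝ × M | ∀ k, 0 < (ω k).1} := by
    rw [Set.ofPred_forall]
    exact MeasurableSet.iInter fun k => measurableSet_lt measurable_const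
      (measurable_fst.comp (measurable_pi_apply k))
  have h2 : MeasurableSet {ω : ℕ → ℝ × M | ∀ m : ℕ, ∃ n, JumpCount n (m : ℝ) ω} := by
    simp only [Set.ofPred_forall, Set.ofPred_exists]
    exact MeasurableSet.iInter fun m => MeasurableSet.iUnion fun n => measurableSet_jumpCount n _
  exact h1.inter h2

/-- Joint measurability in time and path is what makes the disagreement probability measurable in
time. -/
theorem measurable_jumpProcess_prod [Countable S] [MeasurableSpace S] [DiscreteMeasurableSpace S]
    {f : S → M → S} (hf : ∀ i, Measurable (f i)) (i : S) :
    Measurable fun p : ℝ × (ℕ → ℝ × M) => jumpProcess f i p.1.toNNReal p.2 := by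
  refine measurable_to_countable' fun j => ?_
  have h1 : MeasurableSet {p : ℝ × (ℕ → ℝ × M) | NonExplosive p.2} :=
    measurable_snd measurableSet_nonExplosive
  have h2 : MeasurableSet {p : ℝ × (ℕ → ℝ × M) | StateAt f i (p.1.toNNReal : ℝ) p.2 j} :=
    (show Measurable fun p : ℝ × (ℕ → ℝ × M) => ((p.1.toNNReal : ℝ), p.2) by fun_prop)
      (measurableSet_stateAt_prod hf i j)
  have h3 : (fun p : ℝ × (ℕ → ℝ × M) => jumpProcess f i p.1.toNNReal p.2) ⁻¹' {j} =
      {p | NonExplosive p.2} ∩ {p | StateAt f i (p.1.toNNReal : ℝ) p.2 j} ∪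
        {p | NonExplosive p.2}ᶜ ∩ {_p | i = j} := by
    ext p
    by_cases hp : NonExplosive p.2
    · simp [hp, jumpProcess_eq_iff f i hp]
    · simp [hp, jumpProcess]
  rw [h3]
  exact (h1.inter h2).union (h1.compl.inter (.const _))

theorem measurable_jumpProcess [Countable S] [MeasurableSpace S] [DiscreteMeasurableSpace S]
    {f : S → M → S} (hf : ∀ i, Measurable (f i)) (i : S) (t : ℝ≥0) :
    Measurable (jumpProcess f i t) := by
  simpa [Function.comp_def] using
    (measurable_jumpProcess_prod hf i).comp (measurable_prodMk_left (x := (t : ℝ)))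

end JumpPaths

/-! ### Non-explosion and finite-dimensional distributions -/

section JumpPathsLaw

variable {S M : Type*} [MeasurableSpace M] (r : ℝ) [hr : Fact (0 < r)] (μ : Measure M)
  [IsProbabilityMeasure μ]

/-- The count is unique only when holding times are positive, so the union is disjoint only up to
null sets. -/
theorem markedLaw_exists_jumpCount (t : ℝ) {A : ℕ → Set (ℕ → ℝ × M)}
    (hA : ∀ n, MeasurableSet (A n)) :
    markedLaw r μ {ω | ∃ n, JumpCount n t ω ∧ ω ∈ A n} =
      ∑' n, markedLaw r μ {ω | JumpCount n t ω ∧ ω ∈ A n} := by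
  rw [Set.ofPred_exists, measure_iUnion₀]
  · intro m n hmn
    change markedLaw r μ _ = 0
    rw [measure_eq_zero_iff_ae_notMem]
    filter_upwards [ae_holding_pos r μ] with ω hω h
    exact hmn (h.1.1.unique hω h.2.1)
  · exact fun n => ((measurableSet_jumpCount n t).inter (hA n)).nullMeasurableSet

/-- The Poisson weights sum to one, so no mass escapes to infinitely many rings. -/
theorem ae_nonExplosive : ∀ᵐ ω ∂markedLaw r μ, NonExplosive ω := by
  refine (ae_holding_pos r μ).and (ae_all_iff.2 fun m => ?_)
  have h := markedLaw_exists_jumpCount r μ (m : ℝ) (A := fun _ => Set.univ)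
    fun _ => MeasurableSet.univ
  have hm : (0 : ℝ) ≤ m := m.cast_nonneg
  simp only [Set.mem_univ, and_true, markedLaw_jumpCount r μ _ hm,
    tsum_poissonWeight (mul_nonneg hr.out.le hm)] at h
  have hmeas : MeasurableSet {ω : ℕ → ℝ × M | ∃ n, JumpCount n (m : ℝ) ω} := by
    rw [Set.ofPred_exists]
    exact MeasurableSet.iUnion fun n => measurableSet_jumpCount n _
  exact (prob_compl_eq_zero_iff hmeas).2 h

theorem markedLaw_jumpProcess_eq (f : S → M → S) (i : S) (t : ℝ≥0) (j : S) :
    markedLaw r μ {ω | jumpProcess f i t ω = j} = markedLaw r μ {ω | StateAt f i t ω j} := by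
  refine measure_congr ?_
  filter_upwards [ae_nonExplosive r μ] with ω hω
  exact propext (jumpProcess_eq_iff f i hω j)

theorem stepProb_le_one (f : S → M → S) (n : ℕ) (i j : S) : stepProb μ f n i j ≤ 1 := by
  induction n generalizing i with
  | zero => unfold stepProb; split_ifs <;> simp
  | succ n ih =>
    calc stepProb μ f (n + 1) i j ≤ ∫⁻ _, 1 ∂μ := lintegral_mono fun m => ih _
      _ = 1 := by simp

variable [Countable S] [MeasurableSpace S] [DiscreteMeasurableSpace S]

theorem markedLaw_stateAt {f : S → M → S} (hf : ∀ i, Measurable (f i)) (i j : S)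
    {t : ℝ} (ht : 0 ≤ t) :
    markedLaw r μ {ω | StateAt f i t ω j} =
      ∑' n, poissonWeight (r * t) n * stepProb μ f n i j := by
  rw [show {ω | StateAt f i t ω j} = {ω | ∃ n, JumpCount n t ω ∧
      ω ∈ {ω | embeddedChain f i ω n = j}} from rfl,
    markedLaw_exists_jumpCount r μ t fun n => measurableSet_embeddedChain hf i n j]
  refine tsum_congr fun n => ?_
  have h := markedLaw_jumpCount_stateAt r μ hf (ι := Empty) (u := fun k => k.elim)
    (fun k => k.elim) (fun k => k.elim) n i j ht
  simpa using h

theorem markedLaw_stateAt_and {f : S → M → S} (hf : ∀ i, Measurable (f i))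
    {ι : Type*} [Countable ι] {u : ι → ℝ} (hu : ∀ k, 0 ≤ u k) (c : ι → S) (i j : S)
    {t : ℝ} (ht : 0 ≤ t) :
    markedLaw r μ {ω | StateAt f i t ω j ∧ ∀ k, StateAt f i (t + u k) ω (c k)} =
      markedLaw r μ {ω | StateAt f i t ω j} *
        markedLaw r μ {ω | ∀ k, StateAt f j (u k) ω (c k)} := by
  have h1 : {ω | StateAt f i t ω j ∧ ∀ k, StateAt f i (t + u k) ω (c k)} =
      {ω | ∃ n, JumpCount n t ω ∧ ω ∈ {ω | embeddedChain f i ω n = j ∧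
        ∀ k, StateAt f i (t + u k) ω (c k)}} := by
    ext ω
    simp only [StateAt, Set.mem_ofPred_eq, ← exists_and_right, and_assoc]
  rw [h1, markedLaw_exists_jumpCount r μ t, markedLaw_stateAt r μ hf i j ht,
    ← ENNReal.tsum_mul_right]
  · exact tsum_congr fun n => markedLaw_jumpCount_stateAt r μ hf hu c n i j ht
  · exact fun n => (measurableSet_embeddedChain hf i n j).inter
      (measurableSet_forall_stateAt hf i _ _)

theorem markedLaw_forall_stateAt {f : S → M → S} (hf : ∀ i, Measurable (f i)) (n : ℕ)
    {t : ℕ → ℝ} (ht : Monotone t) (ht0 : 0 ≤ t 0) (i : S) (c : ℕ → S) :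
    markedLaw r μ {ω | ∀ k ≤ n, StateAt f i (t k) ω (c k)} =
      markedLaw r μ {ω | StateAt f i (t 0) ω (c 0)} *
        ∏ k ∈ Finset.range n,
          markedLaw r μ {ω | StateAt f (c k) (t (k + 1) - t k) ω (c (k + 1))} := by
  induction n generalizing i t c with
  | zero => simp
  | succ n ih =>
    have h1 : {ω : ℕ → ℝ × M | ∀ k ≤ n + 1, StateAt f i (t k) ω (c k)} =
        {ω | StateAt f i (t 0) ω (c 0) ∧ ∀ k : {k // k ≤ n},
          StateAt f i (t 0 + (t (k + 1) - t 0)) ω (c (k + 1))} := by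
      ext ω
      simp only [Set.mem_ofPred_eq, add_sub_cancel, Subtype.forall]
      refine ⟨fun h => ⟨h 0 (Nat.zero_le _), fun k hk => h (k + 1) (by omega)⟩, ?_⟩
      rintro ⟨h0, h⟩ k hk
      cases k with
      | zero => exact h0
      | succ k => exact h k (by omega)
    have h2 : ∀ k, 0 ≤ t (k + 1) - t 0 := fun k => sub_nonneg.2 (ht (Nat.zero_le _))
    -- Restart at time `t 0` from `c 0`; the shift leaves the time increments unchanged.
    have h3 := ih (t := fun k => t (k + 1) - t 0)
      (fun a b hab => sub_le_sub_right (ht (Nat.succ_le_succ hab)) _) (h2 0) (c 0)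
      (fun k => c (k + 1))
    simp only [sub_sub_sub_cancel_right] at h3
    rw [h1, markedLaw_stateAt_and r μ hf (u := fun k : {k // k ≤ n} => t (k + 1) - t 0)
      (fun k => h2 k) (fun k => c (k + 1)) i (c 0) ht0, Finset.prod_range_succ',
      mul_comm (∏ k ∈ Finset.range n, _)]
    congr 1
    rw [← h3]
    simp only [Subtype.forall]

end JumpPathsLaw

theorem stepProb_one {S M : Type*} [MeasurableSpace M] (μ : Measure M) [MeasurableSpace S]
    [DiscreteMeasurableSpace S] {f : S → M → S} (hf : ∀ i, Measurable (f i)) (i j : S) :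
    stepProb μ f 1 i j = μ {m | f i m = j} := by
  have h : ∀ m, stepProb μ f 0 (f i m) j = Set.indicator {m | f i m = j} 1 m := fun m => by
    by_cases hm : f i m = j <;> simp [stepProb, hm]
  have hm : MeasurableSet {m | f i m = j} := hf i (.singleton j)
  rw [stepProb, lintegral_congr h, lintegral_indicator_one hm]

/-! ### Uniformized chains and their disagreement bound -/

section JumpProcessMarkov

theorem hasSum_measureReal_fiber {Ω S : Type*} [MeasurableSpace Ω] (P : Measure Ω)
    [IsProbabilityMeasure P] [Countable S] [MeasurableSpace S] [MeasurableSingletonClass S]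
    {Y : Ω → S} (hY : Measurable Y) (A : Set Ω) :
    HasSum (fun k => P.real {ω | Y ω = k ∧ ω ∈ A}) (P.real A) := by
  have h1 : ∑' k, P {ω | Y ω = k ∧ ω ∈ A} = P A := by
    have h := tsum_measure_preimage_singleton (μ := P.restrict A) Set.countable_univ (f := Y)
      (fun k _ => hY (.singleton k))
    rw [tsum_univ (fun k => P.restrict A (Y ⁻¹' {k})), Set.preimage_univ,
      Measure.restrict_apply_univ] at h
    rw [← h]
    exact tsum_congr fun k => (Measure.restrict_apply (hY (.singleton k))).symm
  have h2 := ENNReal.hasSum_toReal (f := fun k => P {ω | Y ω = k ∧ ω ∈ A})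
    (by rw [h1]; exact measure_ne_top _ _)
  rw [← ENNReal.tsum_toReal_eq fun k => measure_ne_top P {ω | Y ω = k ∧ ω ∈ A}, h1] at h2
  exact h2

variable {S M : Type*} [MeasurableSpace M] (r : ℝ) [hr : Fact (0 < r)] (μ : Measure M)
  [IsProbabilityMeasure μ] [Countable S] [MeasurableSpace S] [DiscreteMeasurableSpace S]

/-- `hQ` says `Q = r (P - I)`, with `P` the one-step kernel of the embedded chain.
Chapman-Kolmogorov is the Markov property summed over the intermediate state. -/
theorem isTransitionFunction_markedLaw {f : S → M → S} (hf : ∀ i, Measurable (f i))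
    {Q : Matrix S S ℝ}
    (hQ : ∀ i j, Q i j =
      r * (μ.real {m | f i m = j} - open scoped Classical in if i = j then 1 else 0)) :
    IsTransitionFunction Q fun t i j => (markedLaw r μ).real {ω | jumpProcess f i t ω = j} where
  nonneg t i j := measureReal_nonneg
  sum_one t i := by
    simpa using hasSum_measureReal_fiber (markedLaw r μ) (measurable_jumpProcess hf i t) Set.univ
  zero i j := by
    have h : markedLaw r μ {ω | jumpProcess f i 0 ω = j} = markedLaw r μ {_ω | i = j} := by
      refine measure_congr ?_
      filter_upwards [ae_nonExplosive r μ] with ω hω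
      exact propext (by
        change jumpProcess f i 0 ω = j ↔ i = j
        rw [jumpProcess_zero f i hω])
    rw [measureReal_def, h]
    by_cases hij : i = j <;> simp [hij]
  chapman_kolmogorov s t i j := by
    convert hasSum_measureReal_fiber (markedLaw r μ) (measurable_jumpProcess hf i s)
      {ω | jumpProcess f i (s + t) ω = j} using 2 with k
    have h1 : markedLaw r μ {ω | jumpProcess f i s ω = k ∧
        ω ∈ {ω | jumpProcess f i (s + t) ω = j}} =
        markedLaw r μ {ω | StateAt f i s ω k ∧
          ∀ _ : Unit, StateAt f i ((s : ℝ) + (t : ℝ)) ω j} := by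
      refine measure_congr ?_
      filter_upwards [ae_nonExplosive r μ] with ω hω
      refine propext (and_congr (jumpProcess_eq_iff f i hω k) ?_)
      refine (jumpProcess_eq_iff f i hω j).trans ?_
      rw [NNReal.coe_add]
      exact ⟨fun h _ => h, fun h => h ()⟩
    simp only [measureReal_def]
    rw [h1, markedLaw_stateAt_and r μ hf (ι := Unit) (u := fun _ => (t : ℝ)) (fun _ => t.coe_nonneg)
      (fun _ => j) i k s.coe_nonneg, ENNReal.toReal_mul, markedLaw_jumpProcess_eq,
      markedLaw_jumpProcess_eq]
    simp only [forall_const]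
  rate i j := by
    classical
    have bound : ∀ h : ℝ≥0, 0 < h → ‖((markedLaw r μ).real {ω | jumpProcess f i h ω = j} -
        if i = j then 1 else 0) / (h : ℝ) - Q i j‖ ≤ 3 * r ^ 2 * h := fun h hh => by
      have hh' : (0 : ℝ) < h := hh
      -- The Poisson expansion at `a = r h`, divided by `h`, leaves the error `3 r² h`.
      have key := abs_tsum_poissonWeight_sub_le (K := fun n => stepProb μ f n i j)
        (fun n => stepProb_le_one μ f n i j) (mul_nonneg hr.out.le hh'.le)
      have e0 : (stepProb μ f 0 i j).toReal = if i = j then 1 else 0 := by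
        by_cases hij : i = j <;> simp [stepProb, hij]
      simp only [stepProb_one μ hf, e0, ← markedLaw_stateAt r μ hf i j hh'.le,
        ← markedLaw_jumpProcess_eq, ← measureReal_def] at key
      have hQ' : Q i j = r * (μ.real {m | f i m = j} - if i = j then 1 else 0) := by
        convert hQ i j
      rw [hQ', Real.norm_eq_abs, div_sub' hh'.ne', abs_div, abs_of_pos hh', div_le_iff₀ hh']
      rw [← mul_assoc, mul_comm (h : ℝ) r]
      refine key.trans_eq ?_
      ring
    rw [tendsto_iff_norm_sub_tendsto_zero]
    refine squeeze_zero' (g := fun h : ℝ≥0 => 3 * r ^ 2 * (h : ℝ))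
      (Eventually.of_forall fun _ => norm_nonneg _) ?_ ?_
    · filter_upwards [self_mem_nhdsWithin] with h hh
      convert bound h hh
    · have h0 : Tendsto (fun h : ℝ≥0 => 3 * r ^ 2 * (h : ℝ)) (𝓝 0) (𝓝 (3 * r ^ 2 * (0 : ℝ≥0))) :=
        Continuous.tendsto (by fun_prop) 0
      simpa using h0.mono_left nhdsWithin_le_nhds

theorem isMarkovChain_jumpProcess {f : S → M → S} (hf : ∀ i, Measurable (f i))
    {Q : Matrix S S ℝ}
    (hQ : ∀ i j, Q i j =
      r * (μ.real {m | f i m = j} - open scoped Classical in if i = j then 1 else 0)) (i : S) :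
    IsMarkovChain Q i (markedLaw r μ) (jumpProcess f i) where
  measurable := measurable_jumpProcess hf i
  initial := (ae_nonExplosive r μ).mono fun ω hω => jumpProcess_zero f i hω
  right_continuous := (ae_nonExplosive r μ).mono fun ω hω => jumpProcess_right_continuous f i hω
  left_limits := (ae_nonExplosive r μ).mono fun ω hω => jumpProcess_left_limits f i hω
  markov := by
    refine ⟨_, isTransitionFunction_markedLaw r μ hf hQ, fun n t ht c => ?_⟩
    have h1 : markedLaw r μ {ω | ∀ k ≤ n, jumpProcess f i (t k) ω = c k} =
        markedLaw r μ {ω | ∀ k ≤ n, StateAt f i (t k) ω (c k)} := by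
      refine measure_congr ?_
      filter_upwards [ae_nonExplosive r μ] with ω hω
      exact propext (forall₂_congr fun k _ => jumpProcess_eq_iff f i hω (c k))
    rw [h1, markedLaw_forall_stateAt r μ hf n (t := fun k => (t k : ℝ))
      (fun a b hab => NNReal.coe_le_coe.2 (ht hab)) (t 0).2 i c, markedLaw_jumpProcess_eq]
    congr 1
    refine Finset.prod_congr rfl fun k _ => ?_
    rw [ofReal_measureReal, markedLaw_jumpProcess_eq, NNReal.coe_sub (ht k.le_succ)]

/-- The bound `n δ` averaged over the count: the expected number of rings is `r t`. -/
theorem markedLaw_jumpProcess_ne_le {f g : S → M → S} (hf : ∀ i, Measurable (f i))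
    (hg : ∀ i, Measurable (g i)) {δ : ℝ≥0∞} (hδ : ∀ i, μ {m | f i m ≠ g i m} ≤ δ) (i : S)
    (t : ℝ≥0) :
    markedLaw r μ {ω | jumpProcess f i t ω ≠ jumpProcess g i t ω} ≤
      ENNReal.ofReal (r * t) * δ := by
  have h0 : 0 ≤ r * (t : ℝ) := mul_nonneg hr.out.le t.2
  calc markedLaw r μ {ω | jumpProcess f i t ω ≠ jumpProcess g i t ω}
      ≤ markedLaw r μ (⋃ n, {ω | JumpCount n t ω ∧
          embeddedChain f i ω n ≠ embeddedChain g i ω n}) := by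
        refine measure_mono_ae ?_
        filter_upwards [ae_nonExplosive r μ] with ω hω hne
        obtain ⟨n, hn⟩ := hω.exists_jumpCount t.2
        refine Set.mem_iUnion.2 ⟨n, hn, ?_⟩
        rwa [← jumpProcess_eq_embeddedChain f i hω hn, ← jumpProcess_eq_embeddedChain g i hω hn]
    _ ≤ ∑' n, markedLaw r μ {ω | JumpCount n t ω ∧
          embeddedChain f i ω n ≠ embeddedChain g i ω n} := measure_iUnion_le _
    _ ≤ ∑' n : ℕ, poissonWeight (r * t) n * n * δ := ENNReal.tsum_le_tsum fun n => by
        rw [mul_assoc]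
        exact markedLaw_jumpCount_ne_le r μ hf hg hδ n i t.2
    _ = ENNReal.ofReal (r * t) * δ := by
        rw [ENNReal.tsum_mul_right, tsum_poissonWeight_mul_nat h0]

end JumpProcessMarkov

/-! ### Coupling of single jumps and recovery of the rates -/

section Coupling

/-- Any family of laws on a small discrete space is realized by a random map defined on a
probability space in `Type`. -/
theorem exists_random_map {S T : Type*} [Small.{0} S] [Small.{0} T] [MeasurableSpace T]
    [DiscreteMeasurableSpace T] (ρ : S → Measure T) [∀ i, IsProbabilityMeasure (ρ i)] :
    ∃ (M : Type) (_ : MeasurableSpace M) (μ : Measure M) (h : S → M → T),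
      IsProbabilityMeasure μ ∧ (∀ i, Measurable (h i)) ∧
        ∀ i (A : Set T), μ (h i ⁻¹' A) = ρ i A := by
  let _ : MeasurableSpace (Shrink.{0} T) := ⊤
  have me : Measurable (equivShrink.{0} T) := .of_discrete
  have : ∀ k : Shrink.{0} S,
      IsProbabilityMeasure ((ρ ((equivShrink S).symm k)).map (equivShrink.{0} T)) :=
    fun k => Measure.isProbabilityMeasure_map me.aemeasurable
  have mh : ∀ i : S, Measurable fun m : Shrink.{0} S → Shrink.{0} T =>
      (equivShrink T).symm (m (equivShrink S i)) := fun i =>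
    (measurable_from_top (f := (equivShrink.{0} T).symm)).comp (measurable_pi_apply _)
  -- A mark lists one independent value for each state, and `h i` reads the entry at `i`; `Shrink`
  -- keeps the space in `Type`.
  refine ⟨Shrink.{0} S → Shrink.{0} T, inferInstance,
    Measure.infinitePi fun k => (ρ ((equivShrink S).symm k)).map (equivShrink T),
    fun i m => (equivShrink T).symm (m (equivShrink S i)), inferInstance, mh, fun i A => ?_⟩
  have mA : MeasurableSet ((equivShrink.{0} T).symm ⁻¹' A) := trivial
  have h := (measurePreserving_eval_infinitePi
    (fun k : Shrink.{0} S => (ρ ((equivShrink S).symm k)).map (equivShrink.{0} T))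
    (equivShrink S i)).measure_preimage mA.nullMeasurableSet
  refine h.trans ?_
  rw [Measure.map_apply me mA, ← Set.preimage_comp, Equiv.symm_comp_self, Set.preimage_id,
    Equiv.symm_apply_apply]

/-- A coupling of two jump laws out of `i`, with jump probabilities `a` and `b`: common jumps
happen simultaneously and excess jumps happen separately. -/
theorem exists_jump_coupling {S : Type*} [Countable S] [MeasurableSpace S]
    [DiscreteMeasurableSpace S] (i : S) (a b : S → ℝ≥0∞)
    (hab : ∑' j, a j + ∑' j, b j ≤ 1) :
    ∃ ρ : Measure (S × S), IsProbabilityMeasure ρ ∧ (∀ j ≠ i, ρ {p | p.1 = j} = a j) ∧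
      (∀ j ≠ i, ρ {p | p.2 = j} = b j) ∧
      ρ {p | p.1 ≠ p.2} ≤ ∑' j, (a j - b j + (b j - a j)) := by
  classical
  -- Each summand is `max (a j) (b j)`, hence at most `a j + b j`. The unused mass is put on `(i,
  -- i)`, where both chains stay.
  have hle : ∑' j, (min (a j) (b j) + (a j - b j) + (b j - a j)) ≤ 1 := by
    refine le_trans ?_ hab
    rw [← ENNReal.tsum_add]
    refine ENNReal.tsum_le_tsum fun j => ?_
    rw [add_comm (min (a j) (b j)), tsub_add_min]
    gcongr
    exact tsub_le_self
  let ρ : Measure (S × S) := Measure.sum (fun j => min (a j) (b j) • Measure.dirac (j, j) +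
      (a j - b j) • Measure.dirac (j, i) + (b j - a j) • Measure.dirac (i, j)) +
    (1 - ∑' j, (min (a j) (b j) + (a j - b j) + (b j - a j))) • Measure.dirac (i, i)
  have hρ : ∀ A : Set (S × S), ρ A = ∑' j, (min (a j) (b j) * A.indicator 1 (j, j) +
      (a j - b j) * A.indicator 1 (j, i) + (b j - a j) * A.indicator 1 (i, j)) +
      (1 - ∑' j, (min (a j) (b j) + (a j - b j) + (b j - a j))) * A.indicator 1 (i, i) := by
    intro A
    have mA : MeasurableSet A := .of_discrete
    simp only [ρ, Measure.add_apply, Measure.smul_apply, Measure.sum_apply _ mA,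
      Measure.dirac_apply' _ mA, smul_eq_mul]
  refine ⟨ρ, ⟨?_⟩, fun j hj => ?_, fun j hj => ?_, ?_⟩
  · rw [hρ]
    simp only [Set.indicator_univ, Pi.one_apply, mul_one]
    exact add_tsub_cancel_of_le hle
  · rw [hρ, tsum_eq_single j]
    · have h1 : i ≠ j := hj.symm
      simp [h1, add_comm (min (a j) (b j)), tsub_add_min]
    · intro k hk
      have h1 : i ≠ j := hj.symm
      simp [h1, hk]
  · rw [hρ, tsum_eq_single j]
    · have h1 : i ≠ j := hj.symm
      simp [h1, min_comm (a j), add_comm (min (b j) (a j)), tsub_add_min]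
    · intro k hk
      have h1 : i ≠ j := hj.symm
      simp [h1, hk]
  · rw [hρ]
    simp only [Set.indicator_apply, Set.mem_ofPred_eq, ne_eq, not_true_eq_false, if_false,
      mul_zero, zero_add, add_zero]
    refine ENNReal.tsum_le_tsum fun j => add_le_add ?_ ?_ <;>
    · refine mul_le_of_le_one_right' ?_
      split_ifs <;> simp

theorem ofReal_tsub_add_tsub {u v : ℝ} (hu : 0 ≤ u) (hv : 0 ≤ v) :
    ENNReal.ofReal u - ENNReal.ofReal v + (ENNReal.ofReal v - ENNReal.ofReal u) =
      ENNReal.ofReal |u - v| := by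
  rw [← ENNReal.ofReal_sub _ hv, ← ENNReal.ofReal_sub _ hu]
  rcases le_total u v with h | h
  · rw [ENNReal.ofReal_of_nonpos (sub_nonpos.2 h), zero_add, abs_of_nonpos (sub_nonpos.2 h),
      neg_sub]
  · rw [ENNReal.ofReal_of_nonpos (sub_nonpos.2 h), add_zero, abs_of_nonneg (sub_nonneg.2 h)]

/-- A conservative rate matrix is recovered from the off-diagonal jump probabilities. -/
theorem IsConservativeIrreducibleQ.eq_mul_sub {S M : Type*} [Countable S] [MeasurableSpace S]
    [DiscreteMeasurableSpace S] [MeasurableSpace M] {Q : Matrix S S ℝ}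
    (hQ : IsConservativeIrreducibleQ Q) {r : ℝ} (hr : 0 < r) (μ : Measure M)
    [IsProbabilityMeasure μ] {f : S → M → S} (hf : ∀ i, Measurable (f i))
    (h : ∀ i, ∀ j ≠ i, μ {m | f i m = j} = ENNReal.ofReal (Q i j / r)) (i j : S) :
    Q i j = r * (μ.real {m | f i m = j} - open scoped Classical in if i = j then 1 else 0) := by
  classical
  have hreal : ∀ j ≠ i, r * μ.real {m | f i m = j} = Q i j := fun j hj => by
    rw [measureReal_def, h i j hj,
      ENNReal.toReal_ofReal (div_nonneg (hQ.nonneg i j hj.symm) hr.le), mul_div_cancel₀ _ hr.ne']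
  by_cases hij : i = j
  · subst hij
    have h1 : HasSum (fun k => r * μ.real {m | f i m = k}) r := by
      simpa using (hasSum_measureReal_fiber μ (hf i) Set.univ).mul_left r
    have h2 : HasSum (Set.indicator {k | k ≠ i} fun k => r * μ.real {m | f i m = k})
        (-Q i i) := by
      refine (hasSum_subtype_iff_indicator (s := {k | k ≠ i})).1 ?_
      have e : (fun k : {k // k ≠ i} => r * μ.real {m | f i m = k}) =
          fun k : {k // k ≠ i} => Q i k :=
        funext fun k => hreal k k.2
      have hc := hQ.conservative i
      rw [← e] at hc
      exact hc
    -- Restoring the diagonal term to the off-diagonal sum `-Q i i` gives the total mass `r`, which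
    -- determines `Q i i`.
    have h3 := h2.add (hasSum_ite_eq i (r * μ.real {m | f i m = i}))
    have h4 : (fun k => Set.indicator {k | k ≠ i} (fun k => r * μ.real {m | f i m = k}) k +
        if k = i then r * μ.real {m | f i m = i} else 0) =
        fun k => r * μ.real {m | f i m = k} := by
      ext k
      by_cases hk : k = i <;> simp [hk]
    rw [h4] at h3
    have h5 := h1.unique h3
    simp only [if_true]
    linarith
  · rw [if_neg hij, sub_zero, hreal j (Ne.symm hij)]

theorem tsum_indicator_ofReal_div_le {X S : Type*} (Q : X → Matrix S S ℝ) (x : X) {r : ℝ}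
    (hr : 0 < r) (i : S) :
    ∑' j, Set.indicator {j | j ≠ i} (fun j => ENNReal.ofReal (Q x i j / r)) j ≤
      rateBound Q / ENNReal.ofReal r := by
  rw [← tsum_subtype {j | j ≠ i} fun j => ENNReal.ofReal (Q x i j / r)]
  simp only [ENNReal.ofReal_div_of_pos hr]
  simp only [div_eq_mul_inv]
  rw [ENNReal.tsum_mul_right]
  gcongr
  refine le_trans (ENNReal.tsum_le_tsum fun j => ?_)
    (le_iSup (fun i => ∑' j : {j : S // j ≠ i}, ⨆ x, ENNReal.ofReal (Q x i j)) i)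
  exact le_iSup (fun x => ENNReal.ofReal (Q x i j)) x

end Coupling

/-! ### Assembly of the coupled chains -/

theorem corollary1 {d : ℕ} {S : Type*} [Countable S] [MeasurableSpace S]
    [MeasurableSingletonClass S] (Q : EuclideanSpace ℝ (Fin d) → Matrix S S ℝ)
    (hQ : ConditionA2 Q) (x y : EuclideanSpace ℝ (Fin d)) (i₀ : S) :
    ∃ (Ω : Type) (_ : MeasurableSpace Ω) (P : Measure Ω) (Y Y' : ℝ≥0 → Ω → S),
      IsProbabilityMeasure P ∧
      IsMarkovChain (Q x) i₀ P Y ∧ IsMarkovChain (Q y) i₀ P Y' ∧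
      (Measurable fun s : ℝ => P {ω | Y s.toNNReal ω ≠ Y' s.toNNReal ω}) ∧
      ∀ t : ℝ, 0 < t →
        ENNReal.ofReal (1 / t) *
            ∫⁻ s in Set.Ioc 0 t, P {ω | Y s.toNNReal ω ≠ Y' s.toNNReal ω} ≤
          ENNReal.ofReal t * l1Dist (Q x) (Q y) := by
  obtain ⟨r, hr, hκ⟩ : ∃ r : ℝ, 0 < r ∧ rateBound Q + rateBound Q ≤ ENNReal.ofReal r := by
    have h0 : 0 ≤ (rateBound Q).toReal := ENNReal.toReal_nonneg
    -- Twice `κ` leaves room for the jump probabilities of both chains together; the `1` keeps `r`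
    -- positive when `κ = 0`.
    refine ⟨(rateBound Q).toReal + (rateBound Q).toReal + 1, by positivity, ?_⟩
    conv_lhs => rw [← ENNReal.ofReal_toReal hQ.bounded.ne, ← ENNReal.ofReal_add h0 h0]
    exact ENNReal.ofReal_le_ofReal (by linarith)
  have : Fact (0 < r) := ⟨hr⟩
  have hR0 : ENNReal.ofReal r ≠ 0 := by simpa using hr
  have hRtop : ENNReal.ofReal r ≠ ⊤ := ENNReal.ofReal_ne_top
  let a : EuclideanSpace ℝ (Fin d) → S → S → ℝ≥0∞ := fun z i =>
    Set.indicator {j | j ≠ i} fun j => ENNReal.ofReal (Q z i j / r)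
  have ha' : ∀ z i, ∀ j ≠ i, a z i j = ENNReal.ofReal (Q z i j / r) := fun z i j hj => by
    simp [a, hj]
  have hsum : ∀ i, ∑' j, a x i j + ∑' j, a y i j ≤ 1 := fun i => by
    refine (add_le_add (tsum_indicator_ofReal_div_le Q x hr i)
      (tsum_indicator_ofReal_div_le Q y hr i)).trans ?_
    rw [← ENNReal.add_div]
    exact ENNReal.div_le_of_le_mul (by rwa [one_mul])
  choose ρ hρ hρ1 hρ2 hρne using fun i =>
    exists_jump_coupling i (a x i) (a y i) (hsum i)
  obtain ⟨M, _, μ, h, _, mh, hμ⟩ := exists_random_map ρ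
  let f : S → M → S := fun i m => (h i m).1
  let g : S → M → S := fun i m => (h i m).2
  have mf : ∀ i, Measurable (f i) := fun i => measurable_fst.comp (mh i)
  have mg : ∀ i, Measurable (g i) := fun i => measurable_snd.comp (mh i)
  have hf : ∀ i, ∀ j ≠ i, μ {m | f i m = j} = ENNReal.ofReal (Q x i j / r) := fun i j hj => by
    rw [← ha' x i j hj, ← hρ1 i j hj, ← hμ i]
    rfl
  have hg : ∀ i, ∀ j ≠ i, μ {m | g i m = j} = ENNReal.ofReal (Q y i j / r) := fun i j hj => by
    rw [← ha' y i j hj, ← hρ2 i j hj, ← hμ i]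
    rfl
  -- The excess parts of the coupling add up to `|q_ij(x) - q_ij(y)| / r`; this `1 / r` later
  -- cancels the clock rate.
  have hδ : ∀ i, μ {m | f i m ≠ g i m} ≤ l1Dist (Q x) (Q y) / ENNReal.ofReal r := fun i => by
    have h1 : μ {m | f i m ≠ g i m} = ρ i {p | p.1 ≠ p.2} := by
      rw [← hμ i]
      rfl
    rw [h1]
    refine (hρne i).trans ?_
    have h2 : ∀ j, a x i j - a y i j + (a y i j - a x i j) = Set.indicator {j | j ≠ i}
        (fun j => ENNReal.ofReal |Q x i j - Q y i j| / ENNReal.ofReal r) j := fun j => by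
      by_cases hj : j = i
      · simp [a, hj]
      · have hx := div_nonneg ((hQ.isQ x).nonneg i j (Ne.symm hj)) hr.le
        have hy := div_nonneg ((hQ.isQ y).nonneg i j (Ne.symm hj)) hr.le
        rw [ha' x i j hj, ha' y i j hj, ofReal_tsub_add_tsub hx hy, ← sub_div, abs_div,
          abs_of_pos hr, ENNReal.ofReal_div_of_pos hr]
        simp [hj]
    rw [tsum_congr h2, ← tsum_subtype {j | j ≠ i}
      fun j => ENNReal.ofReal |Q x i j - Q y i j| / ENNReal.ofReal r]
    simp only [div_eq_mul_inv]
    rw [ENNReal.tsum_mul_right]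
    gcongr
    exact le_iSup (fun i => ∑' j : {j : S // j ≠ i}, ENNReal.ofReal |Q x i j - Q y i j|) i
  refine ⟨ℕ → ℝ × M, inferInstance, markedLaw r μ, jumpProcess f i₀, jumpProcess g i₀,
    inferInstance, isMarkovChain_jumpProcess r μ mf ((hQ.isQ x).eq_mul_sub hr μ mf hf) i₀,
    isMarkovChain_jumpProcess r μ mg ((hQ.isQ y).eq_mul_sub hr μ mg hg) i₀, ?_, fun t ht => ?_⟩
  · have h1 : MeasurableSet {p : ℝ × (ℕ → ℝ × M) |
        jumpProcess f i₀ p.1.toNNReal p.2 ≠ jumpProcess g i₀ p.1.toNNReal p.2} :=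
      (measurableSet_eq_fun (measurable_jumpProcess_prod mf i₀)
        (measurable_jumpProcess_prod mg i₀)).compl
    exact measurable_measure_prodMk_left h1
  -- The bound linear in `s` is replaced by its value at `t`, so the average is that of a constant.
  · have h1 : ∀ s ∈ Set.Ioc 0 t, markedLaw r μ {ω | jumpProcess f i₀ s.toNNReal ω ≠
        jumpProcess g i₀ s.toNNReal ω} ≤ ENNReal.ofReal t * l1Dist (Q x) (Q y) := fun s hs => by
      refine (markedLaw_jumpProcess_ne_le r μ mf mg hδ i₀ s.toNNReal).trans ?_
      rw [Real.coe_toNNReal s hs.1.le, ENNReal.ofReal_mul hr.le, mul_comm (ENNReal.ofReal r),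
        mul_assoc, ENNReal.mul_div_cancel hR0 hRtop]
      gcongr
      exact hs.2
    calc ENNReal.ofReal (1 / t) * ∫⁻ s in Set.Ioc 0 t, markedLaw r μ
          {ω | jumpProcess f i₀ s.toNNReal ω ≠ jumpProcess g i₀ s.toNNReal ω}
        ≤ ENNReal.ofReal (1 / t) *
            ∫⁻ _ in Set.Ioc 0 t, ENNReal.ofReal t * l1Dist (Q x) (Q y) := by
          gcongr ENNReal.ofReal (1 / t) * ?_
          exact setLIntegral_mono measurable_const h1
      _ = ENNReal.ofReal t * l1Dist (Q x) (Q y) := by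
          rw [setLIntegral_const, Real.volume_Ioc, sub_zero, mul_comm _ (ENNReal.ofReal t),
            ← mul_assoc, ← ENNReal.ofReal_mul (by positivity), one_div_mul_cancel ht.ne',
            ENNReal.ofReal_one, one_mul]
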